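/- Let $V\subset\mathbb R^n$ be a homogeneous cone: a non-empty open set with $\lambda x\in V$ and $x+y\in V$ for all $x,y\in V$, $\lambda>0$, such that $x\in\overline V$, $x\ne 0$ implies $-x\notin\overline V$, and such that the group $G(V)$ of linear maps $A$ of $\mathbb R^n$ with $AV=V$ acts transitively on $V$. Let $V^*=\{x\in\mathbb R^n : x\cdot y>0 \text{ for every } y\in\overline V,\ y\neq 0\}$ be its dual cone. For a cone $W$ ($W=V$ or $W=V^*$) and $x\in W$ let $\Delta_W(x)$ be the Lebesgue measure of the cone interval $\{y\in W : x-y\in W\}$. Let $1\le p<\infty$ and $\beta,\delta\in\mathbb R$, and let $k:V^*\times V\to[0,\infty)$ be a measurable kernel which is $V^*\times V$-homogeneous of order $\beta$, that is, $k((A^{t})^{-1}x,Ay)=|\det A|^{\beta}k(x,y)$ for all $A\in G(V)$, $x\in V^*$, $y\in V$. Assume that $$\int_V k(x,y)\,\Delta_V^{\delta}(y)\,dy<\infty\quad\text{for every }x\in V^*,$$ and $$\operatorname*{ess\,sup}_{x\in V^*}k(x,y)\,\Delta_{V^*}^{-(\delta+\beta)(p-1)+1}(x)<\infty\quad\text{for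 every }y\in V .$$ Then there is a constant $c<\infty$, independent of $f$, such that for every measurable $f:V\to[0,\infty)$, with $Kf(x)=\int_V k(x,y)f(y)\,dy$ for $x\in V^*$, $$\operatorname*{ess\,sup}_{x\in V^*}\Delta_{V^*}(x)\,Kf(x)\le c\left(\int_V f^{p}(y)\,\Delta_V^{\beta p-1}(y)\,dy\right)^{1/p}.$$ -/

import Mathlib

open MeasureTheory
open scoped NNReal ENNReal

/-- A cone in `ℝⁿ`: a non-empty open set, closed under multiplication by positive scalars and
under addition, whose closure contains no pair `x, -x` with `x ≠ 0`. -/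
structure IsOpenCone {n : ℕ} (V : Set (EuclideanSpace ℝ (Fin n))) : Prop where
  nonempty : V.Nonempty
  isOpen : IsOpen V
  smul_mem : ∀ x ∈ V, ∀ r : ℝ, 0 < r → r • x ∈ V
  add_mem : ∀ x ∈ V, ∀ y ∈ V, x + y ∈ V
  pointed : ∀ x ∈ closure V, x ≠ 0 → -x ∉ closure V

/-- The automorphism group `G(V)`: the (automatically invertible) linear maps of `ℝⁿ`
that map `V` onto `V`. -/
def coneAut {n : ℕ} (V : Set (EuclideanSpace ℝ (Fin n))) :
    Set (EuclideanSpace ℝ (Fin n) ≃ₗ[ℝ] EuclideanSpace ℝ (Fin n)) :=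
  {A | A '' V = V}

/-- A homogeneous cone: `G(V)` acts transitively on `V`. -/
structure IsHomogeneousCone {n : ℕ} (V : Set (EuclideanSpace ℝ (Fin n))) : Prop
    extends IsOpenCone V where
  transitive : ∀ x ∈ V, ∀ y ∈ V, ∃ A ∈ coneAut V, A x = y

/-- The dual cone `V* = {x : x · y > 0 for every y ∈ closure V, y ≠ 0}`. -/
def openDual {n : ℕ} (V : Set (EuclideanSpace ℝ (Fin n))) : Set (EuclideanSpace ℝ (Fin n)) :=
  {x | ∀ y ∈ closure V, y ≠ 0 → 0 < inner ℝ x y}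

/-- The cone interval `⟨a, b⟩ = {x ∈ V : a < x < b}`, where `u < v` means `v - u ∈ V`. -/
def coneInterval {n : ℕ} (V : Set (EuclideanSpace ℝ (Fin n))) (a b : EuclideanSpace ℝ (Fin n)) :
    Set (EuclideanSpace ℝ (Fin n)) :=
  {x | x ∈ V ∧ x - a ∈ V ∧ b - x ∈ V}

/-- `Δ_V(x)`: the Lebesgue measure of the cone interval `⟨0, x⟩`. -/
noncomputable def coneDelta {n : ℕ} (V : Set (EuclideanSpace ℝ (Fin n)))
    (x : EuclideanSpace ℝ (Fin n)) : ℝ≥0∞ :=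
  volume (coneInterval V 0 x)

/-- The kernel `k` on `V* × V` is `V* × V`-homogeneous of order `β`:
`k((Aᵗ)⁻¹ x, A y) = |det A|^β k(x, y)` for all `A ∈ G(V)`, `x ∈ V*`, `y ∈ V`.
Here `(Aᵗ)⁻¹` is written as the transpose of `A⁻¹`. -/
def IsDualHomogeneousKernel {n : ℕ} (V : Set (EuclideanSpace ℝ (Fin n))) (β : ℝ)
    (k : EuclideanSpace ℝ (Fin n) → EuclideanSpace ℝ (Fin n) → ℝ≥0) : Prop :=
  ∀ A ∈ coneAut V, ∀ x ∈ openDual V, ∀ y ∈ V,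
    (k (LinearMap.adjoint (A.symm : EuclideanSpace ℝ (Fin n) →ₗ[ℝ] EuclideanSpace ℝ (Fin n)) x)
        (A y) : ℝ) =
      |LinearMap.det (A : EuclideanSpace ℝ (Fin n) →ₗ[ℝ] EuclideanSpace ℝ (Fin n))| ^ β * k x y

/-- The integral operator `Kf(x) = ∫_V k(x, y) f(y) dy`, with values in `[0, ∞]`. -/
noncomputable def coneOperator {n : ℕ} (V : Set (EuclideanSpace ℝ (Fin n)))
    (k : EuclideanSpace ℝ (Fin n) → EuclideanSpace ℝ (Fin n) → ℝ≥0)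
    (f : EuclideanSpace ℝ (Fin n) → ℝ≥0) (x : EuclideanSpace ℝ (Fin n)) : ℝ≥0∞ :=
  ∫⁻ y in V, (k x y : ℝ≥0∞) * (f y : ℝ≥0∞)

/-! ### Cones, their duals and cone intervals. -/

section ConeGeometry

open Set Filter Topology Pointwise

variable {n : ℕ} {V : Set (EuclideanSpace ℝ (Fin n))}

/-! The estimate is Hölder's inequality with a weight, once homogeneity has turned both hypotheses
on `k` into explicit powers. Write Δ and Δ* for the interval volumes of V and V*, and e =
-(δ+β)(p-1)+1. An automorphism A multiplies Δ by |det A|, and its contragredient multiplies Δ* by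
|det A|⁻¹. If the two actions are transitive, comparison with one base point gives ∫ k(x,y) Δ(y)^δ
dy = C₁ Δ*(x)^(-(β+δ+1)) (`exists_lintegral_eq`) and k(x,y) Δ*(x)^e ≤ C₂ Δ(y)^(β-e) for almost every
x (`exists_ae_le`). Splitting k = k^(1-1/p) k^(1/p), and inserting Δ^δ with its compensating power,
leaves exactly Δ*(x)⁻¹ outside and the weight Δ^(βp-1) inside.

Transitivity on V is assumed; on V* it has to be proved (`exists_contragredient_eq`). For w in V*,
compactness gives a point x of V maximizing Δ on a slice {w · x = const}. The Laplace transform φ of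
the indicator of V* scales by |det A|⁻¹, so Δφ is constant on V and x minimizes the smooth function
φ on the slice. By Lagrange multipliers dφ(x) is proportional to w, so x determines w up to a
positive factor. An automorphism carrying a maximizer for w to one for w' therefore carries w to a
multiple of w', and a dilation corrects the multiple. -/

theorem IsOpenCone.convex (hV : IsOpenCone V) : Convex ℝ V := by
  intro x hx y hy a b ha hb hab
  rcases ha.eq_or_lt with rfl | ha
  · obtain rfl : b = 1 := by linarith
    simpa using hy
  rcases hb.eq_or_lt with rfl | hb
  · obtain rfl : a = 1 := by linarith
    simpa using hx
  exact hV.add_mem _ (hV.smul_mem x hx a ha) _ (hV.smul_mem y hy b hb)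

/-- For open V, the sums V + closure V and V + V coincide. -/
theorem IsOpenCone.add_mem_of_mem_closure (hV : IsOpenCone V) {x y : EuclideanSpace ℝ (Fin n)}
    (hx : x ∈ V) (hy : y ∈ closure V) : x + y ∈ V := by
  have h : x + y ∈ V + closure V := Set.add_mem_add hx hy
  rw [hV.isOpen.add_closure] at h
  obtain ⟨a, ha, b, hb, hab⟩ := h
  rw [← hab]
  exact hV.add_mem a ha b hb

theorem IsOpenCone.smul_mem_closure (hV : IsOpenCone V) {x : EuclideanSpace ℝ (Fin n)}
    (hx : x ∈ closure V) {r : ℝ} (hr : 0 < r) : r • x ∈ closure V :=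
  map_mem_closure (continuous_const_smul r) hx fun y hy => hV.smul_mem y hy r hr

/-- A vector of the dual cone is uniformly positive on the closed cone. -/
theorem IsOpenCone.exists_norm_le_inner (hV : IsOpenCone V) {w : EuclideanSpace ℝ (Fin n)}
    (hw : w ∈ openDual V) : ∃ c : ℝ, 0 < c ∧ ∀ y ∈ closure V, c * ‖y‖ ≤ inner ℝ w y := by
  rcases (closure V ∩ Metric.sphere 0 1).eq_empty_or_nonempty with he | hne
  -- Without unit vectors the closed cone is at most {0}, so any constant serves.
  · refine ⟨1, one_pos, fun y hy => ?_⟩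
    by_cases hy0 : y = 0
    · simp [hy0]
    · exfalso
      have hn : 0 < ‖y‖ := norm_pos_iff.2 hy0
      have hmem : ‖y‖⁻¹ • y ∈ closure V ∩ Metric.sphere 0 1 :=
        ⟨hV.smul_mem_closure hy (inv_pos.2 hn), by simp [norm_smul, hn.ne']⟩
      rw [he] at hmem
      exact hmem
  · have hK : IsCompact (closure V ∩ Metric.sphere 0 1) :=
      (isCompact_sphere _ _).inter_left isClosed_closure
    obtain ⟨z, hz, hmin⟩ := hK.exists_isMinOn hne
      (f := fun y => inner ℝ w y) (by fun_prop)
    have hz0 : z ≠ 0 := by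
      rintro rfl
      simpa using hz.2
    refine ⟨inner ℝ w z, hw z hz.1 hz0, fun y hy => ?_⟩
    by_cases hy0 : y = 0
    · simp [hy0]
    · have hn : 0 < ‖y‖ := norm_pos_iff.2 hy0
      have hmem : ‖y‖⁻¹ • y ∈ closure V ∩ Metric.sphere 0 1 :=
        ⟨hV.smul_mem_closure hy (inv_pos.2 hn), by simp [norm_smul, hn.ne']⟩
      have h := hmin hmem
      simp only [mem_ofPred_eq, inner_smul_right] at h
      rw [inv_mul_eq_div, le_div_iff₀ hn] at h
      exact h

/-- A vector of the cone is uniformly positive on the dual cone. -/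
theorem IsOpenCone.exists_ball_norm_le_inner (hV : IsOpenCone V) {u : EuclideanSpace ℝ (Fin n)}
    (hu : u ∈ V) : ∃ c : ℝ, 0 < c ∧ ∀ x ∈ Metric.ball u c, x ∈ V ∧
      ∀ y ∈ openDual V, c * ‖y‖ ≤ inner ℝ x y := by
  obtain ⟨ε, hε, hball⟩ := Metric.isOpen_iff.1 hV.isOpen u hu
  -- A point within ε/3 of u, moved by ε/3 in the direction -y, stays in the ε-ball and hence in V;
  -- pairing it with y yields the bound.
  refine ⟨ε / 3, by positivity, fun x hx => ⟨hball (Metric.ball_subset_ball (by linarith) hx),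
    fun y hy => ?_⟩⟩
  by_cases hy0 : y = 0
  · simp [hy0]
  have hn : 0 < ‖y‖ := norm_pos_iff.2 hy0
  have hmem : x - (ε / 3 * ‖y‖⁻¹) • y ∈ V := by
    apply hball
    rw [Metric.mem_ball, dist_eq_norm] at hx ⊢
    have h1 : x - (ε / 3 * ‖y‖⁻¹) • y - u = (x - u) - (ε / 3 * ‖y‖⁻¹) • y := by abel
    have h2 : ‖(ε / 3 * ‖y‖⁻¹) • y‖ = ε / 3 := by
      rw [norm_smul, Real.norm_of_nonneg (by positivity)]
      field_simp
    rw [h1]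
    have := norm_sub_le (x - u) ((ε / 3 * ‖y‖⁻¹) • y)
    linarith
  have h : 0 ≤ inner ℝ y (x - (ε / 3 * ‖y‖⁻¹) • y) := by
    by_cases h0 : x - (ε / 3 * ‖y‖⁻¹) • y = 0
    · simp [h0]
    · exact (hy _ (subset_closure hmem) h0).le
  rw [inner_sub_right, inner_smul_right, real_inner_self_eq_norm_sq, real_inner_comm] at h
  have h3 : ε / 3 * ‖y‖⁻¹ * ‖y‖ ^ 2 = ε / 3 * ‖y‖ := by field_simp
  linarith

theorem IsOpenCone.isOpen_openDual (hV : IsOpenCone V) : IsOpen (openDual V) := by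
  rw [Metric.isOpen_iff]
  intro w hw
  obtain ⟨c, hc, h⟩ := hV.exists_norm_le_inner hw
  refine ⟨c, hc, fun x hx y hy hy0 => ?_⟩
  have hn : 0 < ‖y‖ := norm_pos_iff.2 hy0
  rw [Metric.mem_ball, dist_eq_norm] at hx
  have h1 : -inner ℝ (x - w) y ≤ ‖x - w‖ * ‖y‖ :=
    (neg_le_abs _).trans (abs_real_inner_le_norm _ _)
  have h2 : ‖x - w‖ * ‖y‖ < c * ‖y‖ := mul_lt_mul_of_pos_right hx hn
  have h3 := h y hy
  rw [inner_sub_left] at h1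
  linarith

theorem smul_mem_openDual {x : EuclideanSpace ℝ (Fin n)} (hx : x ∈ openDual V) {r : ℝ}
    (hr : 0 < r) : r • x ∈ openDual V := fun y hy hy0 => by
  rw [real_inner_smul_left]
  exact mul_pos hr (hx y hy hy0)

theorem isOpen_coneInterval {W : Set (EuclideanSpace ℝ (Fin n))} (hW : IsOpen W)
    (a b : EuclideanSpace ℝ (Fin n)) : IsOpen (coneInterval W a b) :=
  hW.inter ((hW.preimage (continuous_id.sub continuous_const)).inter
    (hW.preimage (continuous_const.sub continuous_id)))

/-- The measure of a cone interval is positive. -/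
theorem coneDelta_ne_zero {W : Set (EuclideanSpace ℝ (Fin n))} (hW : IsOpen W)
    (hsmul : ∀ x ∈ W, ∀ r : ℝ, 0 < r → r • x ∈ W) {x : EuclideanSpace ℝ (Fin n)} (hx : x ∈ W) :
    coneDelta W x ≠ 0 := by
  refine ((isOpen_coneInterval hW 0 x).measure_pos volume ⟨(1 / 2 : ℝ) • x, ?_⟩).ne'
  have h := hsmul x hx (1 / 2) (by norm_num)
  refine ⟨h, by simpa using h, ?_⟩
  have h2 : x - (1 / 2 : ℝ) • x = (1 / 2 : ℝ) • x := by module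
  rwa [h2]

/-- The measure of a cone interval is finite if some linear form is uniformly positive on the
cone. -/
theorem coneDelta_ne_top {W : Set (EuclideanSpace ℝ (Fin n))} {w : EuclideanSpace ℝ (Fin n)}
    {c : ℝ} (hc : 0 < c) (h : ∀ y ∈ W, c * ‖y‖ ≤ inner ℝ w y) (x : EuclideanSpace ℝ (Fin n)) :
    coneDelta W x ≠ ∞ := by
  -- For y and x - y in W, c‖y‖ ≤ w · y ≤ w · x, so the interval lies in a ball.
  refine ((measure_mono (fun y hy => ?_)).trans_lt
    (Metric.isBounded_closedBall (x := 0) (r := inner ℝ w x / c)).measure_lt_top).ne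
  rw [mem_closedBall_zero_iff, le_div_iff₀ hc, mul_comm]
  have h1 := h y hy.1
  have h2 := h _ hy.2.2
  rw [inner_sub_right] at h2
  have : 0 ≤ c * ‖x - y‖ := by positivity
  linarith

theorem measurable_coneDelta {W : Set (EuclideanSpace ℝ (Fin n))} (hW : IsOpen W) :
    Measurable (coneDelta W) := by
  have h : MeasurableSet {z : EuclideanSpace ℝ (Fin n) × EuclideanSpace ℝ (Fin n) |
      z.2 ∈ W ∧ z.2 - 0 ∈ W ∧ z.1 - z.2 ∈ W} :=
    ((hW.preimage continuous_snd).inter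
      ((hW.preimage (continuous_snd.sub continuous_const)).inter
        (hW.preimage (continuous_fst.sub continuous_snd)))).measurableSet
  exact measurable_measure_prodMk_left (ν := volume) h

end ConeGeometry

/-! ### Automorphisms, contragredients and changes of variables. -/

section Automorphisms

open Set Filter Topology Pointwise

variable {n : ℕ} {V : Set (EuclideanSpace ℝ (Fin n))}

/-- The contragredient `(Aᵗ)⁻¹` of an invertible linear map `A`. -/
noncomputable def contragredient
    (A : EuclideanSpace ℝ (Fin n) ≃ₗ[ℝ] EuclideanSpace ℝ (Fin n)) :
    EuclideanSpace ℝ (Fin n) ≃ₗ[ℝ] EuclideanSpace ℝ (Fin n) :=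
  LinearEquiv.ofLinearMap
    (LinearMap.adjoint (A.symm : EuclideanSpace ℝ (Fin n) →ₗ[ℝ] EuclideanSpace ℝ (Fin n)))
    (LinearMap.adjoint (A : EuclideanSpace ℝ (Fin n) →ₗ[ℝ] EuclideanSpace ℝ (Fin n)))
    (by rw [← LinearMap.adjoint_comp]; simp) (by rw [← LinearMap.adjoint_comp]; simp)

theorem inner_contragredient_apply
    (A : EuclideanSpace ℝ (Fin n) ≃ₗ[ℝ] EuclideanSpace ℝ (Fin n))
    (x y : EuclideanSpace ℝ (Fin n)) : inner ℝ (contragredient A x) (A y) = inner ℝ x y := by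
  change inner ℝ (LinearMap.adjoint
    (A.symm : EuclideanSpace ℝ (Fin n) →ₗ[ℝ] EuclideanSpace ℝ (Fin n)) x) (A y) = _
  rw [LinearMap.adjoint_inner_left]
  simp

theorem LinearMap.det_adjoint_euclideanSpace
    (f : EuclideanSpace ℝ (Fin n) →ₗ[ℝ] EuclideanSpace ℝ (Fin n)) :
    LinearMap.det (LinearMap.adjoint f) = LinearMap.det f := by
  have b := EuclideanSpace.basisFun (Fin n) ℝ
  rw [← LinearMap.det_toMatrix b.toBasis, ← LinearMap.det_toMatrix b.toBasis f,
    LinearMap.toMatrix_adjoint, Matrix.det_conjTranspose, star_trivial]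

theorem det_contragredient (A : EuclideanSpace ℝ (Fin n) ≃ₗ[ℝ] EuclideanSpace ℝ (Fin n)) :
    LinearMap.det (contragredient A : EuclideanSpace ℝ (Fin n) →ₗ[ℝ] EuclideanSpace ℝ (Fin n)) =
      (LinearMap.det (A : EuclideanSpace ℝ (Fin n) →ₗ[ℝ] EuclideanSpace ℝ (Fin n)))⁻¹ := by
  rw [← LinearEquiv.det_coe_symm]
  exact LinearMap.det_adjoint_euclideanSpace _

theorem preimage_eq_of_mem_coneAut
    {A : EuclideanSpace ℝ (Fin n) ≃ₗ[ℝ] EuclideanSpace ℝ (Fin n)} (hA : A ∈ coneAut V) :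
    A ⁻¹' V = V := by
  have h : A '' V = V := hA
  conv_lhs => rw [← h]
  exact A.injective.preimage_image V

theorem preimage_contragredient_openDual
    {A : EuclideanSpace ℝ (Fin n) ≃ₗ[ℝ] EuclideanSpace ℝ (Fin n)} (hA : A ∈ coneAut V) :
    contragredient A ⁻¹' openDual V = openDual V := by
  have hcl : A ⁻¹' closure V = closure V := by
    have h := A.toContinuousLinearEquiv.toHomeomorph.preimage_closure V
    have h2 := preimage_eq_of_mem_coneAut hA
    simp only [ContinuousLinearEquiv.coe_toHomeomorph,
      LinearEquiv.coe_toContinuousLinearEquiv'] at h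
    rw [h, h2]
  ext x
  constructor
  · intro hx y hy hy0
    have h := hx (A y) (by rwa [← hcl] at hy) (by simpa using hy0)
    rwa [inner_contragredient_apply] at h
  · intro hx y hy hy0
    have h := hx (A.symm y) (by rw [← hcl]; simpa using hy) (by simpa using hy0)
    rwa [← inner_contragredient_apply A, A.apply_symm_apply] at h

variable {W : Set (EuclideanSpace ℝ (Fin n))}

theorem ofReal_abs_det_ne_zero (A : EuclideanSpace ℝ (Fin n) ≃ₗ[ℝ] EuclideanSpace ℝ (Fin n)) :
    ENNReal.ofReal
      |LinearMap.det (A : EuclideanSpace ℝ (Fin n) →ₗ[ℝ] EuclideanSpace ℝ (Fin n))| ≠ 0 := by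
  simpa using A.isUnit_det'.ne_zero

theorem coneDelta_linearEquiv (A : EuclideanSpace ℝ (Fin n) ≃ₗ[ℝ] EuclideanSpace ℝ (Fin n))
    (hA : A ⁻¹' W = W) (x : EuclideanSpace ℝ (Fin n)) :
    coneDelta W (A x) = ENNReal.ofReal
      |LinearMap.det (A : EuclideanSpace ℝ (Fin n) →ₗ[ℝ] EuclideanSpace ℝ (Fin n))| *
        coneDelta W x := by
  have h : coneInterval W 0 (A x) =
      (A : EuclideanSpace ℝ (Fin n) →ₗ[ℝ] EuclideanSpace ℝ (Fin n)) '' coneInterval W 0 x := by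
    have hmem : ∀ z, A z ∈ W ↔ z ∈ W := fun z => by
      conv_rhs => rw [← hA]
      rfl
    ext y
    obtain ⟨y, rfl⟩ := A.surjective y
    have h2 : A y ∈ (A : EuclideanSpace ℝ (Fin n) →ₗ[ℝ] EuclideanSpace ℝ (Fin n)) ''
        coneInterval W 0 x ↔ y ∈ coneInterval W 0 x := A.injective.mem_set_image
    rw [h2]
    simp only [coneInterval, mem_ofPred_eq, sub_zero, ← map_sub, hmem]
  rw [coneDelta, h, Measure.addHaar_image_linearMap, coneDelta]

/-- Change of variables by a linear automorphism preserving a set. -/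
theorem map_restrict_linearEquiv
    (A : EuclideanSpace ℝ (Fin n) ≃ₗ[ℝ] EuclideanSpace ℝ (Fin n)) (hA : A ⁻¹' W = W) :
    volume.restrict W = ENNReal.ofReal
      |LinearMap.det (A : EuclideanSpace ℝ (Fin n) →ₗ[ℝ] EuclideanSpace ℝ (Fin n))| •
        (volume.restrict W).map A.toContinuousLinearEquiv.toHomeomorph.toMeasurableEquiv := by
  have hd := A.isUnit_det'.ne_zero
  set e := A.toContinuousLinearEquiv.toHomeomorph.toMeasurableEquiv with he
  have h1 : Measure.map e volume = ENNReal.ofReal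
      |(LinearMap.det (A : EuclideanSpace ℝ (Fin n) →ₗ[ℝ] EuclideanSpace ℝ (Fin n)))⁻¹| •
        (volume : Measure (EuclideanSpace ℝ (Fin n))) :=
    Measure.map_linearMap_addHaar_eq_smul_addHaar volume hd
  have h2 : (volume.restrict W).map e = (volume.map e).restrict W := by
    rw [e.restrict_map]
    congr 2
    exact hA.symm
  rw [h2, h1, Measure.restrict_smul, smul_smul, ← ENNReal.ofReal_mul (abs_nonneg _), ← abs_mul,
    mul_inv_cancel₀ hd]
  simp

theorem setLIntegral_linearEquiv
    (A : EuclideanSpace ℝ (Fin n) ≃ₗ[ℝ] EuclideanSpace ℝ (Fin n)) (hA : A ⁻¹' W = W)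
    (f : EuclideanSpace ℝ (Fin n) → ℝ≥0∞) :
    ∫⁻ y in W, f y = ENNReal.ofReal
      |LinearMap.det (A : EuclideanSpace ℝ (Fin n) →ₗ[ℝ] EuclideanSpace ℝ (Fin n))| *
        ∫⁻ y in W, f (A y) := by
  conv_lhs => rw [map_restrict_linearEquiv A hA]
  rw [lintegral_smul_measure, lintegral_map_equiv]
  rfl

theorem setIntegral_linearEquiv
    (A : EuclideanSpace ℝ (Fin n) ≃ₗ[ℝ] EuclideanSpace ℝ (Fin n)) (hA : A ⁻¹' W = W)
    (f : EuclideanSpace ℝ (Fin n) → ℝ) :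
    ∫ y in W, f y =
      |LinearMap.det (A : EuclideanSpace ℝ (Fin n) →ₗ[ℝ] EuclideanSpace ℝ (Fin n))| *
        ∫ y in W, f (A y) := by
  conv_lhs => rw [map_restrict_linearEquiv A hA]
  rw [integral_smul_measure, integral_map_equiv, ENNReal.toReal_ofReal (abs_nonneg _)]
  rfl

theorem ae_restrict_linearEquiv
    (A : EuclideanSpace ℝ (Fin n) ≃ₗ[ℝ] EuclideanSpace ℝ (Fin n)) (hA : A ⁻¹' W = W)
    {P : EuclideanSpace ℝ (Fin n) → Prop} (h : ∀ᵐ y ∂(volume.restrict W), P y) :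
    ∀ᵐ y ∂(volume.restrict W), P (A y) := by
  rw [map_restrict_linearEquiv A hA, Measure.ae_ennreal_smul_measure_eq
    (ofReal_abs_det_ne_zero A)] at h
  exact ae_of_ae_map (MeasurableEquiv.measurable _).aemeasurable h

end Automorphisms

/-! ### Existence of slice maximizers. -/

section SliceMaximum

open Set Filter Topology Pointwise

variable {n : ℕ} {V : Set (EuclideanSpace ℝ (Fin n))}

/-- The measure of the sections of a compact subset of a product is upper semicontinuous. -/
theorem IsCompact.upperSemicontinuous_measure_section {X : Type*} [TopologicalSpace X]
    [T2Space X] {K : Set (X × EuclideanSpace ℝ (Fin n))} (hK : IsCompact K) :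
    UpperSemicontinuous fun x => volume (Prod.mk x ⁻¹' K) := by
  intro x b hb
  -- Outer regularity gives an open U around the section; by compactness, nearby sections stay
  -- inside U.
  obtain ⟨U, hU, hUo, hUb⟩ := Set.exists_isOpen_lt_of_lt _ _ hb
  have hcl : IsClosed (Prod.fst '' (K ∩ Prod.snd ⁻¹' Uᶜ)) :=
    ((hK.inter_right (hUo.isClosed_compl.preimage continuous_snd)).image
      continuous_fst).isClosed
  have hx : x ∉ Prod.fst '' (K ∩ Prod.snd ⁻¹' Uᶜ) := by
    rintro ⟨⟨x', y⟩, ⟨h1, h2⟩, rfl⟩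
    exact h2 (hU h1)
  filter_upwards [hcl.isOpen_compl.mem_nhds hx] with z hz
  refine (measure_mono fun y hy => ?_).trans_lt hUb
  by_contra hyU
  exact hz ⟨(z, y), ⟨hy, hyU⟩, rfl⟩

/-- A neighbourhood of 0 in V would dilate to the whole space, which is not pointed. -/
theorem IsOpenCone.zero_notMem (hV : IsOpenCone V) (hn : n ≠ 0) :
    (0 : EuclideanSpace ℝ (Fin n)) ∉ V := by
  intro hu
  have hall : V = univ := by
    refine eq_univ_of_forall fun y => ?_
    obtain ⟨ε, hε, hball⟩ := Metric.isOpen_iff.1 hV.isOpen 0 hu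
    by_cases hy : y = 0
    · rwa [hy]
    have hny : 0 < ‖y‖ := norm_pos_iff.2 hy
    have hm : (ε / 2 * ‖y‖⁻¹) • y ∈ V := by
      apply hball
      rw [mem_ball_zero_iff, norm_smul, Real.norm_of_nonneg (by positivity)]
      field_simp
      norm_num
    have h := hV.smul_mem _ hm ((ε / 2 * ‖y‖⁻¹)⁻¹) (by positivity)
    rwa [smul_smul, inv_mul_cancel₀ (by positivity), one_smul] at h
  have : Nonempty (Fin n) := ⟨⟨0, Nat.pos_of_ne_zero hn⟩⟩
  obtain ⟨y, hy⟩ := exists_ne (0 : EuclideanSpace ℝ (Fin n))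
  exact hV.pointed y (by simp [hall]) hy (by simp [hall])

/-- `x` maximizes the measure of cone intervals on the slice through `x` orthogonal to `w`. -/
def IsSliceMax (V : Set (EuclideanSpace ℝ (Fin n))) (w x : EuclideanSpace ℝ (Fin n)) : Prop :=
  ∀ z ∈ V, inner ℝ w z = inner ℝ w x → coneDelta V z ≤ coneDelta V x

/-- On the slices of a cone by hyperplanes, cone intervals attain their maximal measure. -/
theorem IsOpenCone.exists_isSliceMax (hV : IsOpenCone V) {w : EuclideanSpace ℝ (Fin n)}
    (hw : w ∈ openDual V) (hn : n ≠ 0) : ∃ x ∈ V, IsSliceMax V w x := by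
  obtain ⟨c, hc, hcV⟩ := hV.exists_norm_le_inner hw
  set T : Set (EuclideanSpace ℝ (Fin n)) := closure V ∩ {x | inner ℝ w x = 1} with hT
  have hTc : IsCompact T := by
    refine Metric.isCompact_of_isClosed_isBounded (isClosed_closure.inter
      (isClosed_eq (by fun_prop) continuous_const))
      (Metric.isBounded_closedBall (x := 0) (r := 1 / c) |>.subset fun y hy => ?_)
    rw [mem_closedBall_zero_iff, le_div_iff₀ hc, mul_comm]
    exact (hcV y hy.1).trans_eq hy.2
  -- Closed cone intervals over the closed slice: compactness holds here, and semicontinuity gives a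
  -- maximum.
  set K : Set (EuclideanSpace ℝ (Fin n) × EuclideanSpace ℝ (Fin n)) :=
    {z | z.1 ∈ T ∧ z.2 ∈ closure V ∧ z.1 - z.2 ∈ closure V} with hKdef
  have hKc : IsCompact K := by
    refine IsCompact.of_isClosed_subset
      (hTc.prod (isCompact_closedBall (0 : EuclideanSpace ℝ (Fin n)) (1 / c))) ?_ ?_
    · exact (hTc.isClosed.preimage continuous_fst).inter
        ((isClosed_closure.preimage continuous_snd).inter
          (isClosed_closure.preimage (continuous_fst.sub continuous_snd)))
    · rintro ⟨x, y⟩ ⟨hx, hy, hxy⟩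
      refine ⟨hx, ?_⟩
      rw [mem_closedBall_zero_iff, le_div_iff₀ hc, mul_comm]
      have h1 := hcV y hy
      have h2 := hcV _ hxy
      have h3 : inner ℝ w x = 1 := hx.2
      simp only [inner_sub_right] at h2
      have : 0 ≤ c * ‖x - y‖ := by positivity
      linarith
  have husc := hKc.upperSemicontinuous_measure_section
  have hle : ∀ z ∈ T, coneDelta V z ≤ volume (Prod.mk z ⁻¹' K) := fun z hz =>
    measure_mono fun y hy => ⟨hz, subset_closure hy.1, subset_closure hy.2.2⟩
  obtain ⟨u, hu⟩ := hV.nonempty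
  have hne : u ≠ 0 := fun h => hV.zero_notMem hn (h ▸ hu)
  have hwu : 0 < inner ℝ w u := hw u (subset_closure hu) hne
  have huT : (inner ℝ w u)⁻¹ • u ∈ T := by
    refine ⟨subset_closure (hV.smul_mem u hu _ (inv_pos.2 hwu)), ?_⟩
    simp [inner_smul_right, hwu.ne']
  obtain ⟨x, hxT, hxmax⟩ := (husc.upperSemicontinuousOn T).exists_isMaxOn ⟨_, huT⟩ hTc
  have hpos : volume (Prod.mk x ⁻¹' K) ≠ 0 := by
    have h1 := (hle _ huT).trans (hxmax huT)
    have h2 := coneDelta_ne_zero hV.isOpen hV.smul_mem (hV.smul_mem u hu _ (inv_pos.2 hwu))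
    exact (pos_iff_ne_zero.2 h2 |>.trans_le h1).ne'
  -- The frontier of a convex set is null, so closed and open intervals have the same volume.
  have hfr : volume (frontier V) = 0 := hV.convex.addHaar_frontier volume
  have hfr' : volume ((fun y => x - y) ⁻¹' frontier V) = 0 := by
    rwa [(Measure.measurePreserving_sub_left volume x).measure_preimage
      isClosed_frontier.measurableSet.nullMeasurableSet]
  have hae : volume (Prod.mk x ⁻¹' K) ≤ coneDelta V x := by
    calc volume (Prod.mk x ⁻¹' K)
        ≤ volume (coneInterval V 0 x ∪ (frontier V ∪ (fun y => x - y) ⁻¹' frontier V)) := by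
          refine measure_mono fun y hy => ?_
          by_cases h1 : y ∈ V
          · by_cases h2 : x - y ∈ V
            · exact Or.inl ⟨h1, by simpa using h1, h2⟩
            · right; right
              change x - y ∈ frontier V
              rw [hV.isOpen.frontier_eq]
              exact ⟨hy.2.2, h2⟩
          · right; left
            rw [hV.isOpen.frontier_eq]
            exact ⟨hy.2.1, h1⟩
      _ ≤ coneDelta V x := by
          refine (measure_union_le _ _).trans ?_
          rw [measure_union_null hfr hfr', add_zero]
          rfl
  have hxV : x ∈ V := by
    by_contra hxV
    -- If x were outside V, its closed interval would lie in the frontier of V, since y ∈ V and x -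
    -- y ∈ closure V force x ∈ V; its volume is positive.
    refine hpos (measure_mono_null (fun y hy => ?_) hfr)
    rw [hV.isOpen.frontier_eq]
    refine ⟨hy.2.1, fun hyV => hxV ?_⟩
    simpa using hV.add_mem_of_mem_closure hyV hy.2.2
  refine ⟨x, hxV, fun z hz hzx => ?_⟩
  exact ((hle z ⟨subset_closure hz, hzx.trans hxT.2⟩).trans
    (hxmax ⟨subset_closure hz, hzx.trans hxT.2⟩)).trans hae

end SliceMaximum

/-! ### The Laplace transform and transitivity on the dual cone. -/

section DualTransitivity

open Set Filter Topology Pointwise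

variable {n : ℕ} {V : Set (EuclideanSpace ℝ (Fin n))}

theorem integrable_one_add_norm_mul_exp_neg {c : ℝ} (hc : 0 < c) :
    Integrable (fun y : EuclideanSpace ℝ (Fin n) => (1 + ‖y‖) * Real.exp (-(c * ‖y‖))) := by
  have hfin : (Module.finrank ℝ (EuclideanSpace ℝ (Fin n)) : ℝ) < (n + 1 : ℝ) := by simp
  -- The constant comes from exp t ≥ t^(n+2)/(n+2)! at t = c(1+‖y‖): one power absorbs the factor
  -- 1+‖y‖ and n+1 remain for integrability.
  refine Integrable.mono' ((integrable_one_add_norm (μ := volume) hfin).const_mul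
    (Real.exp c * (n + 2).factorial / c ^ (n + 2))) (by fun_prop) (ae_of_all _ fun y => ?_)
  have ht : 0 < 1 + ‖y‖ := by positivity
  rw [Real.norm_of_nonneg (by positivity)]
  have h := Real.pow_div_factorial_le_exp (c * (1 + ‖y‖)) (by positivity) (n + 2)
  have hr : (1 + ‖y‖) ^ (-(n + 1 : ℝ)) = ((1 + ‖y‖) ^ (n + 1))⁻¹ := by
    rw [Real.rpow_neg ht.le]
    norm_cast
  have he : Real.exp (c * (1 + ‖y‖)) = Real.exp c * Real.exp (c * ‖y‖) := by
    rw [← Real.exp_add]; ring_nf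
  rw [hr, Real.exp_neg]
  rw [he, mul_pow, div_le_iff₀ (by positivity)] at h
  rw [← div_eq_mul_inv, ← div_eq_mul_inv, div_le_div_iff₀ (by positivity) (by positivity),
    div_mul_eq_mul_div, le_div_iff₀ (by positivity)]
  calc (1 + ‖y‖) * (1 + ‖y‖) ^ (n + 1) * c ^ (n + 2) = c ^ (n + 2) * (1 + ‖y‖) ^ (n + 2) := by
        ring
    _ ≤ _ := h
    _ = _ := by ring

/-- The Laplace transform of the indicator function of the dual cone. -/
noncomputable def dualLaplace (V : Set (EuclideanSpace ℝ (Fin n)))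
    (x : EuclideanSpace ℝ (Fin n)) : ℝ :=
  ∫ y in openDual V, Real.exp (-inner ℝ x y)

theorem dualLaplace_nonneg (x : EuclideanSpace ℝ (Fin n)) : 0 ≤ dualLaplace V x :=
  integral_nonneg fun _ => (Real.exp_pos _).le

/-- Substituting the contragredient of A preserves the dual cone and the pairing, leaving only its
determinant. -/
theorem dualLaplace_linearEquiv
    {A : EuclideanSpace ℝ (Fin n) ≃ₗ[ℝ] EuclideanSpace ℝ (Fin n)} (hA : A ∈ coneAut V)
    (x : EuclideanSpace ℝ (Fin n)) :
    dualLaplace V (A x) =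
      |LinearMap.det (A : EuclideanSpace ℝ (Fin n) →ₗ[ℝ] EuclideanSpace ℝ (Fin n))|⁻¹ *
        dualLaplace V x := by
  rw [dualLaplace, setIntegral_linearEquiv _ (preimage_contragredient_openDual hA),
    det_contragredient, abs_inv]
  congr 1
  refine integral_congr_ae (ae_of_all _ fun y => ?_)
  simp only []
  rw [real_inner_comm, inner_contragredient_apply, real_inner_comm]

/-- The Laplace transform is differentiable on the cone, with nonzero radial derivative. -/
theorem IsOpenCone.exists_hasFDerivAt_dualLaplace (hV : IsOpenCone V)
    (hne : (openDual V).Nonempty) (hn : n ≠ 0) {x : EuclideanSpace ℝ (Fin n)} (hx : x ∈ V) :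
    ∃ L : EuclideanSpace ℝ (Fin n) →L[ℝ] ℝ, HasFDerivAt (dualLaplace V) L x ∧ L x ≠ 0 := by
  obtain ⟨c, hc, hball⟩ := hV.exists_ball_norm_le_inner hx
  have hmeas : MeasurableSet (openDual V) := hV.isOpen_openDual.measurableSet
  have hbound := (integrable_one_add_norm_mul_exp_neg (n := n) hc).integrableOn (s := openDual V)
  set F' : EuclideanSpace ℝ (Fin n) → EuclideanSpace ℝ (Fin n) → EuclideanSpace ℝ (Fin n) →L[ℝ] ℝ :=
    fun x y => -(Real.exp (-inner ℝ x y) • innerSL ℝ y) with hF'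
  have hle : ∀ y ∈ openDual V, ∀ z ∈ Metric.ball x c,
      ‖F' z y‖ ≤ (1 + ‖y‖) * Real.exp (-(c * ‖y‖)) := by
    intro y hy z hz
    have h := (hball z hz).2 y hy
    rw [hF', norm_neg, norm_smul, innerSL_apply_norm, Real.norm_of_nonneg (Real.exp_pos _).le,
      mul_comm]
    gcongr
    linarith
  have hFmeas : ∀ z, AEStronglyMeasurable (fun y => Real.exp (-inner ℝ z y))
      (volume.restrict (openDual V)) := fun z => by fun_prop
  have hF'meas : AEStronglyMeasurable (F' x) (volume.restrict (openDual V)) :=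
    Continuous.aestronglyMeasurable (by fun_prop)
  have hF'int : Integrable (F' x) (volume.restrict (openDual V)) :=
    hbound.mono' hF'meas ((ae_restrict_mem hmeas).mono fun y hy =>
      hle y hy x (Metric.mem_ball_self hc))
  have hder : HasFDerivAt (dualLaplace V) (∫ y in openDual V, F' x y) x := by
    refine hasFDerivAt_integral_of_dominated_of_fderiv_le (Metric.ball_mem_nhds x hc)
      (Eventually.of_forall hFmeas) ?_ hF'meas ((ae_restrict_mem hmeas).mono hle) hbound
      (ae_of_all _ fun y z _ => ?_)
    · refine hbound.mono' (hFmeas x) ((ae_restrict_mem hmeas).mono fun y hy => ?_)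
      have h := (hball x (Metric.mem_ball_self hc)).2 y hy
      rw [Real.norm_of_nonneg (Real.exp_pos _).le]
      have h1 : Real.exp (-inner ℝ x y) ≤ Real.exp (-(c * ‖y‖)) :=
        Real.exp_le_exp.2 (by linarith)
      have h2 : 0 ≤ ‖y‖ * Real.exp (-(c * ‖y‖)) := by positivity
      linarith
    · have h1 : HasFDerivAt (fun z => -inner ℝ z y) (-(innerSL ℝ y)) z := by
        have h0 : (fun z : EuclideanSpace ℝ (Fin n) => -inner ℝ z y) = fun z => (-innerSL ℝ y) z := by
          ext z
          simp [real_inner_comm]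
        rw [h0]
        exact (-(innerSL ℝ y)).hasFDerivAt
      have h2 := h1.exp
      rw [smul_neg] at h2
      exact h2
  refine ⟨_, hder, ?_⟩
  rw [ContinuousLinearMap.integral_apply hF'int]
  have hx0 : x ≠ 0 := fun h => hV.zero_notMem hn (h ▸ hx)
  -- The radial derivative is minus the integral of a positive function over a non-empty open set.
  have hpos : 0 < ∫ y in openDual V, Real.exp (-inner ℝ x y) * inner ℝ y x := by
    have hp : ∀ y ∈ openDual V, 0 < Real.exp (-inner ℝ x y) * inner ℝ y x := fun y hy =>
      mul_pos (Real.exp_pos _) (hy x (subset_closure hx) hx0)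
    rw [setIntegral_pos_iff_support_of_nonneg_ae]
    · refine (hV.isOpen_openDual.measure_pos volume hne).trans_le (measure_mono fun y hy => ?_)
      exact ⟨(hp y hy).ne', hy⟩
    · exact (ae_restrict_mem hmeas).mono fun y hy => (hp y hy).le
    · have h := (hF'int.apply_continuousLinearMap x).neg
      refine h.congr (ae_of_all _ fun y => ?_)
      simp [hF']
  have heq : ∫ y in openDual V, F' x y x =
      -∫ y in openDual V, Real.exp (-inner ℝ x y) * inner ℝ y x := by
    rw [← integral_neg]
    rfl
  rw [heq]
  exact (neg_neg_of_pos hpos).ne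

/-- A slice maximizer determines the direction of the slice. -/
theorem IsHomogeneousCone.exists_smul_eq_of_isSliceMax (hV : IsHomogeneousCone V) (hn : n ≠ 0)
    {w w' x : EuclideanSpace ℝ (Fin n)} (hw : w ∈ openDual V) (hw' : w' ∈ openDual V)
    (hx : x ∈ V) (h : IsSliceMax V w x) (h' : IsSliceMax V w' x) :
    ∃ r : ℝ, 0 < r ∧ w' = r • w := by
  have hx0 : x ≠ 0 := fun h => hV.zero_notMem hn (h ▸ hx)
  obtain ⟨L, hL, hLx⟩ := hV.exists_hasFDerivAt_dualLaplace ⟨w, hw⟩ hn hx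
  obtain ⟨c, hc, hcV⟩ := hV.exists_norm_le_inner hw
  -- Writing z = A x, the bound on Δ says |det A| ≤ 1, and the Laplace transform scales by the
  -- inverse.
  have hmin : ∀ z ∈ V, coneDelta V z ≤ coneDelta V x → dualLaplace V x ≤ dualLaplace V z := by
    intro z hz hzx
    obtain ⟨A, hA, rfl⟩ := hV.transitive x hx z hz
    rw [coneDelta_linearEquiv A (preimage_eq_of_mem_coneAut hA)] at hzx
    rw [dualLaplace_linearEquiv hA]
    refine le_mul_of_one_le_left (dualLaplace_nonneg x) ((one_le_inv₀ ?_).2 ?_)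
    · exact abs_pos.2 A.isUnit_det'.ne_zero
    · rw [← ENNReal.ofReal_le_one]
      have h1 := coneDelta_ne_zero hV.isOpen hV.smul_mem hx
      have h2 := coneDelta_ne_top hc (fun y hy => hcV y (subset_closure hy)) x
      by_contra! hlt
      have := ENNReal.mul_lt_mul_left h1 h2 hlt
      rw [one_mul] at this
      exact absurd hzx (not_le.2 this)
  -- Lagrange multipliers: L vanishes on the kernel of v, so the two forms are proportional, with
  -- the ratio fixed by their values at x.
  have key : ∀ v ∈ openDual V, IsSliceMax V v x → ∀ e, inner ℝ v e = L e / L x * inner ℝ v x := by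
    intro v hv hvx e
    have hvx0 : 0 < inner ℝ v x := hv x (subset_closure hx) hx0
    have hker : ∀ d, inner ℝ v d = 0 → L d = 0 := by
      intro d hd
      have hline : HasDerivAt (fun t : ℝ => x + t • d) d 0 := by
        simpa using ((hasDerivAt_id (0 : ℝ)).smul_const d).const_add x
      have hL0 : HasFDerivAt (dualLaplace V) L (x + (0 : ℝ) • d) := by simpa using hL
      have hcomp := hL0.comp_hasDerivAt (0 : ℝ) hline
      refine IsLocalMin.hasDerivAt_eq_zero ?_ hcomp
      have hmem : ∀ᶠ t in 𝓝 (0 : ℝ), x + t • d ∈ V :=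
        hline.continuousAt.eventually_mem (hV.isOpen.mem_nhds (by simpa using hx))
      filter_upwards [hmem] with t ht
      have := hmin _ ht (hvx _ ht (by simp [inner_add_right, inner_smul_right, hd]))
      simpa using this
    have h0 := hker (e - (inner ℝ v e / inner ℝ v x) • x) (by
      rw [inner_sub_right, inner_smul_right]
      field_simp
      ring)
    rw [map_sub, map_smul, smul_eq_mul, sub_eq_zero] at h0
    rw [h0]
    field_simp
  have hwx : 0 < inner ℝ w x := hw x (subset_closure hx) hx0
  have hwx' : 0 < inner ℝ w' x := hw' x (subset_closure hx) hx0
  refine ⟨inner ℝ w' x / inner ℝ w x, by positivity, ext_inner_right ℝ fun e => ?_⟩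
  rw [real_inner_smul_left, key w hw h e, key w' hw' h' e]
  field_simp

/-- The contragredient action of the automorphism group of a homogeneous cone is transitive on
the dual cone. -/
theorem IsHomogeneousCone.exists_contragredient_eq (hV : IsHomogeneousCone V)
    {w w' : EuclideanSpace ℝ (Fin n)} (hw : w ∈ openDual V) (hw' : w' ∈ openDual V) :
    ∃ A ∈ coneAut V, contragredient A w = w' := by
  rcases eq_or_ne n 0 with rfl | hn
  · obtain ⟨x, hx⟩ := hV.nonempty
    obtain ⟨A, hA, -⟩ := hV.transitive x hx x hx
    exact ⟨A, hA, Subsingleton.elim _ _⟩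
  obtain ⟨x, hx, hmax⟩ := hV.exists_isSliceMax hw hn
  obtain ⟨x', hx', hmax'⟩ := hV.exists_isSliceMax hw' hn
  obtain ⟨A, hA, rfl⟩ := hV.transitive x hx x' hx'
  have hAV := preimage_eq_of_mem_coneAut hA
  have hAw : contragredient A w ∈ openDual V := by
    rw [← preimage_contragredient_openDual hA] at hw
    exact hw
  -- A maps slices for w to slices for its contragredient image and multiplies all interval volumes
  -- by the same factor.
  have hmaxA : IsSliceMax V (contragredient A w) (A x) := by
    intro z hz hzx
    obtain ⟨z, rfl⟩ := A.surjective z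
    rw [inner_contragredient_apply, inner_contragredient_apply] at hzx
    rw [coneDelta_linearEquiv A hAV, coneDelta_linearEquiv A hAV]
    gcongr
    exact hmax z (by rw [← hAV]; exact hz) hzx
  obtain ⟨r, hr, hrw⟩ := hV.exists_smul_eq_of_isSliceMax hn hw' hAw hx' hmax' hmaxA
  -- Here `contragredient A w = r • w'`; dilating A by r divides its contragredient by r.
  refine ⟨A.trans (LinearEquiv.smulOfNeZero ℝ _ r hr.ne'), ?_, ?_⟩
  · have h1 : A '' V = V := hA
    have h2 : (fun y : EuclideanSpace ℝ (Fin n) => r • y) '' V = V := by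
      refine Subset.antisymm ?_ fun y hy =>
        ⟨r⁻¹ • y, hV.smul_mem y hy _ (inv_pos.2 hr), smul_inv_smul₀ hr.ne' y⟩
      rintro _ ⟨y, hy, rfl⟩
      exact hV.smul_mem y hy r hr
    change (fun y => r • A y) '' V = V
    have h3 : (fun y => r • A y) '' V = (fun y => r • y) '' (A '' V) :=
      (image_image (fun y => r • y) A V).symm
    rw [h3, h1, h2]
  · refine ext_inner_right ℝ fun e => ?_
    obtain ⟨e, rfl⟩ := (A.trans (LinearEquiv.smulOfNeZero ℝ _ r hr.ne')).surjective e
    rw [inner_contragredient_apply]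
    have h3 : A.trans (LinearEquiv.smulOfNeZero ℝ _ r hr.ne') e = r • A e := rfl
    rw [h3, inner_smul_right, ← real_inner_smul_left, ← hrw, inner_contragredient_apply]

end DualTransitivity

/-! ### Explicit power bounds for homogeneous kernels. -/

section KernelBounds

open Set Filter Topology

/-- Fubini applies to a measurable superset that is almost everywhere equal; almost all of its
sections agree with the original ones up to null sets. This is needed because the kernel is only
almost everywhere measurable. -/
theorem MeasureTheory.Measure.ae_ae_comm_of_nullMeasurableSet {α β : Type*} [MeasurableSpace α]
    [MeasurableSpace β] {μ : Measure α} {ν : Measure β} [SFinite μ] [SFinite ν]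
    {P : α → β → Prop} (hP : NullMeasurableSet {z : α × β | P z.1 z.2} (μ.prod ν))
    (h : ∀ᵐ y ∂ν, ∀ᵐ x ∂μ, P x y) : ∀ᵐ x ∂μ, ∀ᵐ y ∂ν, P x y := by
  obtain ⟨t, ht, htm, hts⟩ := hP.exists_measurable_superset_ae_eq
  have h1 : ∀ᵐ y ∂ν, ∀ᵐ x ∂μ, (x, y) ∈ t := by
    filter_upwards [h] with y hy
    filter_upwards [hy] with x hx using ht hx
  have h2 := (Measure.ae_ae_comm (p := fun x y => (x, y) ∈ t) htm).2 h1
  filter_upwards [h2, Measure.ae_ae_of_ae_prod hts.mem_iff] with x hx hx'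
  filter_upwards [hx, hx'] with y hy hy' using hy'.1 hy

variable {n : ℕ} {V : Set (EuclideanSpace ℝ (Fin n))}

theorem IsOpenCone.coneDelta_ne_zero (hV : IsOpenCone V) {y : EuclideanSpace ℝ (Fin n)}
    (hy : y ∈ V) : coneDelta V y ≠ 0 :=
  _root_.coneDelta_ne_zero hV.isOpen hV.smul_mem hy

theorem IsOpenCone.coneDelta_ne_top (hV : IsOpenCone V) (hne : (openDual V).Nonempty)
    (y : EuclideanSpace ℝ (Fin n)) : coneDelta V y ≠ ∞ := by
  obtain ⟨w, hw⟩ := hne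
  obtain ⟨c, hc, hcV⟩ := hV.exists_norm_le_inner hw
  exact _root_.coneDelta_ne_top hc (fun y hy => hcV y (subset_closure hy)) y

theorem IsOpenCone.coneDelta_openDual_ne_zero (hV : IsOpenCone V) {x : EuclideanSpace ℝ (Fin n)}
    (hx : x ∈ openDual V) : coneDelta (openDual V) x ≠ 0 :=
  _root_.coneDelta_ne_zero hV.isOpen_openDual (fun _ hx _ hr => smul_mem_openDual hx hr) hx

theorem IsOpenCone.coneDelta_openDual_ne_top (hV : IsOpenCone V)
    (x : EuclideanSpace ℝ (Fin n)) : coneDelta (openDual V) x ≠ ∞ := by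
  obtain ⟨u, hu⟩ := hV.nonempty
  obtain ⟨c, hc, h⟩ := hV.exists_ball_norm_le_inner hu
  exact _root_.coneDelta_ne_top hc (h u (Metric.mem_ball_self hc)).2 x

theorem coneDelta_openDual_contragredient
    {A : EuclideanSpace ℝ (Fin n) ≃ₗ[ℝ] EuclideanSpace ℝ (Fin n)} (hA : A ∈ coneAut V)
    (x : EuclideanSpace ℝ (Fin n)) :
    coneDelta (openDual V) (contragredient A x) = (ENNReal.ofReal
      |LinearMap.det (A : EuclideanSpace ℝ (Fin n) →ₗ[ℝ] EuclideanSpace ℝ (Fin n))|)⁻¹ *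
        coneDelta (openDual V) x := by
  rw [coneDelta_linearEquiv _ (preimage_contragredient_openDual hA), det_contragredient, abs_inv,
    ENNReal.ofReal_inv_of_pos (abs_pos.2 A.isUnit_det'.ne_zero)]

variable {β : ℝ} {k : EuclideanSpace ℝ (Fin n) → EuclideanSpace ℝ (Fin n) → ℝ≥0}

theorem IsDualHomogeneousKernel.coe_apply (hk : IsDualHomogeneousKernel V β k)
    {A : EuclideanSpace ℝ (Fin n) ≃ₗ[ℝ] EuclideanSpace ℝ (Fin n)} (hA : A ∈ coneAut V)
    {x y : EuclideanSpace ℝ (Fin n)} (hx : x ∈ openDual V) (hy : y ∈ V) :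
    (k (contragredient A x) (A y) : ℝ≥0∞) = ENNReal.ofReal
      |LinearMap.det (A : EuclideanSpace ℝ (Fin n) →ₗ[ℝ] EuclideanSpace ℝ (Fin n))| ^ β *
        k x y := by
  have h := hk A hA x hx y hy
  rw [← ENNReal.ofReal_coe_nnreal (p := k x y), ← ENNReal.ofReal_coe_nnreal,
    ENNReal.ofReal_rpow_of_pos (abs_pos.2 A.isUnit_det'.ne_zero), ← ENNReal.ofReal_mul
    (by positivity), ← h]
  rfl

/-- Moving a base point x₀ to x by a contragredient contributes |det A|^β from the kernel, |det A|^δ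
from the weight and |det A| from dy. The product is the corresponding power of the ratio of Δ* at
the two points. -/
theorem IsDualHomogeneousKernel.exists_lintegral_eq (hk : IsDualHomogeneousKernel V β k)
    (hV : IsHomogeneousCone V) (hne : (openDual V).Nonempty) {δ : ℝ}
    (hint : ∀ x ∈ openDual V, ∫⁻ y in V, (k x y : ℝ≥0∞) * coneDelta V y ^ δ < ∞) :
    ∃ C : ℝ≥0∞, C ≠ ∞ ∧ ∀ x ∈ openDual V, ∫⁻ y in V, (k x y : ℝ≥0∞) * coneDelta V y ^ δ =
      C * coneDelta (openDual V) x ^ (-(β + δ + 1)) := by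
  obtain ⟨x₀, hx₀⟩ := hne
  have h0 := hV.coneDelta_openDual_ne_zero hx₀
  have h1 := hV.coneDelta_openDual_ne_top x₀
  refine ⟨(∫⁻ y in V, (k x₀ y : ℝ≥0∞) * coneDelta V y ^ δ) *
    coneDelta (openDual V) x₀ ^ (β + δ + 1), ENNReal.mul_ne_top (hint x₀ hx₀).ne
      (ENNReal.rpow_ne_top_of_ne_zero h0 h1), fun x hx => ?_⟩
  obtain ⟨A, hA, rfl⟩ := hV.exists_contragredient_eq hx₀ hx
  have hAV := preimage_eq_of_mem_coneAut hA
  rw [coneDelta_openDual_contragredient hA, setLIntegral_linearEquiv A hAV]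
  have ha := ofReal_abs_det_ne_zero A
  have ha' : ENNReal.ofReal
    |LinearMap.det (A : EuclideanSpace ℝ (Fin n) →ₗ[ℝ] EuclideanSpace ℝ (Fin n))| ≠ ∞ :=
    ENNReal.ofReal_ne_top
  have hcongr : ∀ y ∈ V, (k (contragredient A x₀) (A y) : ℝ≥0∞) * coneDelta V (A y) ^ δ =
      ENNReal.ofReal
        |LinearMap.det (A : EuclideanSpace ℝ (Fin n) →ₗ[ℝ] EuclideanSpace ℝ (Fin n))| ^ (β + δ) *
        (k x₀ y * coneDelta V y ^ δ) := by
    intro y hy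
    rw [hk.coe_apply hA hx₀ hy, coneDelta_linearEquiv A hAV, ENNReal.mul_rpow_of_ne_top ha'
      (hV.coneDelta_ne_top ⟨x₀, hx₀⟩ y), ENNReal.rpow_add _ _ ha ha']
    ring
  rw [setLIntegral_congr_fun hV.isOpen.measurableSet hcongr]
  generalize ENNReal.ofReal
    |LinearMap.det (A : EuclideanSpace ℝ (Fin n) →ₗ[ℝ] EuclideanSpace ℝ (Fin n))| = a at ha ha' ⊢
  rw [lintegral_const_mul' _ _ (ENNReal.rpow_ne_top_of_ne_zero ha ha'),
    ENNReal.mul_rpow_of_ne_top (by simp [ha]) h1, ENNReal.inv_rpow, ← ENNReal.rpow_neg, neg_neg,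
    mul_comm (a ^ (β + δ + 1)), mul_assoc, ← mul_assoc (_ ^ (β + δ + 1)),
    ← ENNReal.rpow_add _ _ h0 h1, add_neg_cancel, ENNReal.rpow_zero, one_mul,
    ENNReal.rpow_add (β + δ) 1 ha ha', ENNReal.rpow_one]
  ring

/-- The bound at one point y₀ is pulled back to y by an automorphism; linear changes of variable
preserve null sets. One constant serves all y, but the exceptional set of x may depend on y. -/
theorem IsDualHomogeneousKernel.exists_ae_le (hk : IsDualHomogeneousKernel V β k)
    (hV : IsHomogeneousCone V) (hne : (openDual V).Nonempty) {e : ℝ}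
    (hsup : ∀ y ∈ V, essSup (fun x => (k x y : ℝ≥0∞) * coneDelta (openDual V) x ^ e)
        (volume.restrict (openDual V)) < ∞) :
    ∃ C : ℝ≥0∞, C ≠ ∞ ∧ ∀ y ∈ V, ∀ᵐ x ∂(volume.restrict (openDual V)),
      (k x y : ℝ≥0∞) * coneDelta (openDual V) x ^ e ≤ C * coneDelta V y ^ (β - e) := by
  obtain ⟨y₀, hy₀⟩ := hV.nonempty
  have h0 := hV.coneDelta_ne_zero hy₀
  have h1 := hV.coneDelta_ne_top hne y₀
  refine ⟨essSup (fun x => (k x y₀ : ℝ≥0∞) * coneDelta (openDual V) x ^ e)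
    (volume.restrict (openDual V)) * coneDelta V y₀ ^ (-(β - e)),
    ENNReal.mul_ne_top (hsup y₀ hy₀).ne (ENNReal.rpow_ne_top_of_ne_zero h0 h1), fun y hy => ?_⟩
  obtain ⟨A, hA, rfl⟩ := hV.transitive y hy y₀ hy₀
  have hB := preimage_contragredient_openDual hA
  have hle := ae_restrict_linearEquiv _ hB (ENNReal.ae_le_essSup
    (μ := volume.restrict (openDual V))
    fun x => (k x (A y) : ℝ≥0∞) * coneDelta (openDual V) x ^ e)
  have hy0 := hV.coneDelta_ne_zero hy
  have hy1 := hV.coneDelta_ne_top hne y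
  have ha := ofReal_abs_det_ne_zero A
  have ha' : ENNReal.ofReal
    |LinearMap.det (A : EuclideanSpace ℝ (Fin n) →ₗ[ℝ] EuclideanSpace ℝ (Fin n))| ≠ ∞ :=
    ENNReal.ofReal_ne_top
  filter_upwards [hle, ae_restrict_mem hV.isOpen_openDual.measurableSet] with x hx hxV
  rw [hk.coe_apply hA hxV hy, coneDelta_openDual_contragredient hA] at hx
  rw [coneDelta_linearEquiv A (preimage_eq_of_mem_coneAut hA)]
  generalize essSup (fun x => (k x (A y) : ℝ≥0∞) * coneDelta (openDual V) x ^ e)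
    (volume.restrict (openDual V)) = S at hx ⊢
  generalize ENNReal.ofReal
    |LinearMap.det (A : EuclideanSpace ℝ (Fin n) →ₗ[ℝ] EuclideanSpace ℝ (Fin n))| = a
    at ha ha' hx ⊢
  rw [ENNReal.mul_rpow_of_ne_top (by simp [ha]) (hV.coneDelta_openDual_ne_top x),
    ENNReal.inv_rpow, ← ENNReal.rpow_neg] at hx
  rw [ENNReal.mul_rpow_of_ne_top ha' hy1, mul_assoc, mul_assoc, ← ENNReal.rpow_add _ _ hy0 hy1,
    neg_add_cancel, ENNReal.rpow_zero, mul_one]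
  calc (k x y : ℝ≥0∞) * coneDelta (openDual V) x ^ e
      = a ^ β * k x y * (a ^ (-e) * coneDelta (openDual V) x ^ e) * a ^ (-(β - e)) := by
        have h2 : a ^ β * a ^ (-e) * a ^ (-(β - e)) = 1 := by
          rw [← ENNReal.rpow_add _ _ ha ha', ← ENNReal.rpow_add _ _ ha ha']
          ring_nf
          exact ENNReal.rpow_zero
        calc _ = a ^ β * a ^ (-e) * a ^ (-(β - e)) *
              ((k x y : ℝ≥0∞) * coneDelta (openDual V) x ^ e) := by rw [h2, one_mul]
          _ = _ := by ring
    _ ≤ S * a ^ (-(β - e)) := by gcongr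

end KernelBounds

/-! ### The weighted Hölder estimate. -/

theorem theorem3p10 (n : ℕ) (V : Set (EuclideanSpace ℝ (Fin n))) (hV : IsHomogeneousCone V)
    (p : ℝ) (hp : 1 ≤ p) (β δ : ℝ)
    (k : EuclideanSpace ℝ (Fin n) → EuclideanSpace ℝ (Fin n) → ℝ≥0)
    (hkm : AEMeasurable (Function.uncurry k)
      ((volume.restrict (openDual V)).prod (volume.restrict V)))
    (hk : IsDualHomogeneousKernel V β k)
    (hint : ∀ x ∈ openDual V, ∫⁻ y in V, (k x y : ℝ≥0∞) * coneDelta V y ^ δ < ∞)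
    (hsup : ∀ y ∈ V,
      essSup (fun x => (k x y : ℝ≥0∞) * coneDelta (openDual V) x ^ (-(δ + β) * (p - 1) + 1))
        (volume.restrict (openDual V)) < ∞) :
    ∃ c : ℝ≥0, ∀ f : EuclideanSpace ℝ (Fin n) → ℝ≥0, AEMeasurable f (volume.restrict V) →
      essSup (fun x => coneDelta (openDual V) x * coneOperator V k f x)
          (volume.restrict (openDual V)) ≤
        c * (∫⁻ y in V, (f y : ℝ≥0∞) ^ p * coneDelta V y ^ (β * p - 1)) ^ (1 / p) := by
  rcases (openDual V).eq_empty_or_nonempty with hemp | hne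
  · refine ⟨0, fun f _ => ?_⟩
    simp [hemp]
  have hp0 : 0 < p := by linarith
  have hq : 0 ≤ 1 - 1 / p := by
    rw [sub_nonneg, div_le_one hp0]
    exact hp
  have hp1 : 0 ≤ 1 / p := by positivity
  obtain ⟨C₁, hC₁, hF⟩ := hk.exists_lintegral_eq hV hne hint
  obtain ⟨C₂, hC₂, hS⟩ := hk.exists_ae_le hV hne hsup
  have hVm := hV.isOpen.measurableSet
  have hdm := hV.isOpen_openDual.measurableSet
  have hΔ := measurable_coneDelta hV.isOpen
  have hΔd := measurable_coneDelta hV.isOpen_openDual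
  set e : ℝ := -(δ + β) * (p - 1) + 1 with he
  -- Exchanges the quantifiers, so that for almost every fixed x the bound can be used under the
  -- integral in y.
  have hjoint : ∀ᵐ x ∂(volume.restrict (openDual V)), ∀ᵐ y ∂(volume.restrict V),
      (k x y : ℝ≥0∞) * coneDelta (openDual V) x ^ e ≤ C₂ * coneDelta V y ^ (β - e) := by
    refine Measure.ae_ae_comm_of_nullMeasurableSet ?_ ((ae_restrict_mem hVm).mono hS)
    refine nullMeasurableSet_le ?_ ?_
    · exact hkm.coe_nnreal_ennreal.mul
        ((hΔd.comp measurable_fst).pow_const e).aemeasurable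
    · exact (((hΔ.comp measurable_snd).pow_const _).const_mul C₂).aemeasurable
  refine ⟨(C₁ ^ (1 - 1 / p) * C₂ ^ (1 / p)).toNNReal, fun f hf => essSup_le_of_ae_le _ ?_⟩
  rw [ENNReal.coe_toNNReal (ENNReal.mul_ne_top (ENNReal.rpow_ne_top_of_nonneg hq hC₁)
    (ENNReal.rpow_ne_top_of_nonneg hp1 hC₂))]
  filter_upwards [hjoint, ae_restrict_mem hdm, Measure.ae_ae_of_ae_prod hkm.ae_eq_mk]
    with x hx hxV hxk
  have hkx : AEMeasurable (fun y => (k x y : ℝ≥0∞)) (volume.restrict V) :=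
    (AEMeasurable.congr (hkm.measurable_mk.comp measurable_prodMk_left).aemeasurable
      (Filter.EventuallyEq.symm hxk)).coe_nnreal_ennreal
  have hD0 := hV.coneDelta_openDual_ne_zero hxV
  have hD1 := hV.coneDelta_openDual_ne_top x
  generalize hD : coneDelta (openDual V) x = D at hx hD0 hD1
  -- The inserted powers of Δ cancel: δ(1-1/p) - δ(p-1)/p = 0. This form of Hölder allows the weight
  -- 1-1/p to be 0, so p = 1 is included.
  have hholder : coneOperator V k f x ≤
      (∫⁻ y in V, (k x y : ℝ≥0∞) * coneDelta V y ^ δ) ^ (1 - 1 / p) *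
      (∫⁻ y in V, (k x y : ℝ≥0∞) * ((f y : ℝ≥0∞) ^ p * coneDelta V y ^ (-δ * (p - 1)))) ^
        (1 / p) := by
    refine le_trans (le_of_eq ?_) (ENNReal.lintegral_mul_norm_pow_le
      (hkx.mul (hΔ.pow_const δ).aemeasurable) (hkx.mul ((hf.coe_nnreal_ennreal.pow_const p).mul
        (hΔ.pow_const _).aemeasurable)) hq hp1 (by ring))
    refine setLIntegral_congr_fun hVm fun y hy => ?_
    have h0 := hV.coneDelta_ne_zero hy
    have h1 := hV.coneDelta_ne_top hne y
    change (k x y : ℝ≥0∞) * f y = (k x y * coneDelta V y ^ δ) ^ (1 - 1 / p) *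
      (k x y * ((f y : ℝ≥0∞) ^ p * coneDelta V y ^ (-δ * (p - 1)))) ^ (1 / p)
    simp only [ENNReal.mul_rpow_of_nonneg _ _ hq, ENNReal.mul_rpow_of_nonneg _ _ hp1,
      ← ENNReal.rpow_mul]
    have h2 : coneDelta V y ^ (δ * (1 - 1 / p)) * coneDelta V y ^ (-δ * (p - 1) * (1 / p)) = 1 := by
      rw [← ENNReal.rpow_add _ _ h0 h1]
      convert ENNReal.rpow_zero using 2
      field_simp
      ring
    have h3 : (k x y : ℝ≥0∞) ^ (1 - 1 / p) * (k x y : ℝ≥0∞) ^ (1 / p) = k x y := by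
      rw [← ENNReal.rpow_add_of_nonneg _ _ hq hp1, sub_add_cancel, ENNReal.rpow_one]
    have h4 : p * (1 / p) = 1 := by field_simp
    rw [h4, ENNReal.rpow_one]
    calc (k x y : ℝ≥0∞) * f y = ((k x y : ℝ≥0∞) ^ (1 - 1 / p) * (k x y : ℝ≥0∞) ^ (1 / p)) *
          (coneDelta V y ^ (δ * (1 - 1 / p)) * coneDelta V y ^ (-δ * (p - 1) * (1 / p))) * f y := by
          rw [h2, h3, mul_one]
      _ = _ := by ring
  have hsecond : ∫⁻ y in V, (k x y : ℝ≥0∞) *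
      ((f y : ℝ≥0∞) ^ p * coneDelta V y ^ (-δ * (p - 1))) ≤
      C₂ * D ^ (-e) * ∫⁻ y in V, (f y : ℝ≥0∞) ^ p * coneDelta V y ^ (β * p - 1) := by
    rw [← lintegral_const_mul' _ _ (ENNReal.mul_ne_top hC₂
      (ENNReal.rpow_ne_top_of_ne_zero hD0 hD1))]
    refine lintegral_mono_ae ?_
    filter_upwards [hx, ae_restrict_mem hVm] with y hy hyV
    have h0 := hV.coneDelta_ne_zero hyV
    have h1 := hV.coneDelta_ne_top hne y
    -- By the choice of e, β - e = βp - 1 + δ(p-1).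
    have hexp : coneDelta V y ^ (β * p - 1) =
        coneDelta V y ^ (β - e) * coneDelta V y ^ (-δ * (p - 1)) := by
      rw [← ENNReal.rpow_add _ _ h0 h1, he]
      ring_nf
    have hDe : D ^ e * D ^ (-e) = 1 := by
      rw [← ENNReal.rpow_add _ _ hD0 hD1, add_neg_cancel, ENNReal.rpow_zero]
    calc (k x y : ℝ≥0∞) * ((f y : ℝ≥0∞) ^ p * coneDelta V y ^ (-δ * (p - 1)))
        = (k x y * D ^ e) * (D ^ (-e) * ((f y : ℝ≥0∞) ^ p *
            coneDelta V y ^ (-δ * (p - 1)))) := by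
          calc _ = (k x y : ℝ≥0∞) * (D ^ e * D ^ (-e)) * ((f y : ℝ≥0∞) ^ p *
              coneDelta V y ^ (-δ * (p - 1))) := by rw [hDe, mul_one]
            _ = _ := by ring
      _ ≤ (C₂ * coneDelta V y ^ (β - e)) * (D ^ (-e) * ((f y : ℝ≥0∞) ^ p *
            coneDelta V y ^ (-δ * (p - 1)))) := by gcongr
      _ = _ := by
          rw [hexp]
          ring
  rw [hF x hxV, hD] at hholder
  generalize ∫⁻ y in V, (f y : ℝ≥0∞) ^ p * coneDelta V y ^ (β * p - 1) = I at hsecond ⊢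
  -- The exponents 1, -(β+δ+1)(1-1/p) and -e/p add up to 0, which is what fixes e in the hypothesis.
  have hDpow : D * (D ^ (-(β + δ + 1) * (1 - 1 / p)) * D ^ (-e * (1 / p))) = 1 := by
    conv_lhs => rw [← ENNReal.rpow_one D]
    rw [← ENNReal.rpow_mul, ← ENNReal.rpow_mul, ← ENNReal.rpow_add _ _ hD0 hD1,
      ← ENNReal.rpow_add _ _ hD0 hD1]
    convert ENNReal.rpow_zero using 2
    rw [he]
    field_simp
    ring
  calc D * coneOperator V k f x
      ≤ D * ((C₁ * D ^ (-(β + δ + 1))) ^ (1 - 1 / p) * (C₂ * D ^ (-e) * I) ^ (1 / p)) := by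
        refine mul_le_mul_right (hholder.trans ?_) D
        gcongr
    _ = D * (D ^ (-(β + δ + 1) * (1 - 1 / p)) * D ^ (-e * (1 / p))) *
          (C₁ ^ (1 - 1 / p) * C₂ ^ (1 / p) * I ^ (1 / p)) := by
        simp only [ENNReal.mul_rpow_of_nonneg _ _ hq, ENNReal.mul_rpow_of_nonneg _ _ hp1,
          ← ENNReal.rpow_mul]
        ring
    _ = C₁ ^ (1 - 1 / p) * C₂ ^ (1 / p) * I ^ (1 / p) := by rw [hDpow, one_mul]
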